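/- For a symmetric real $d\times d$ matrix $\Theta=(\theta_{ij})$ with zero diagonal, let $\mathbb P_\Theta$ be the law on $\{\pm1\}^d$ with $\mathbb P_\Theta(x)\propto\exp\big(\sum_{i,j=1}^d\theta_{ij}x_ix_j\big)$, let $\mathbb P_{\Theta,n}$ be the law of $n$ independent observations $X_1,\dots,X_n$ from it, and let $G(\Theta)$ be the graph on $\{1,\dots,d\}$ whose edges are the pairs $\{i,j\}$, $i\ne j$, with $\theta_{ij}\neq0$. All graphs have vertex set $\{1,\dots,d\}$; $E(G)$ is the edge set and $V(G)$ the set of non-isolated vertices of $G$; a subgraph of $G$ is a graph $H$ with $E(H)\subseteq E(G)$. For a class $\mathcal G_1$ of graphs and $\theta\in\mathbb R$ put $$\mathcal S(\mathcal G_1,\theta)=\Big\{\Theta:\ \Theta=\Theta^T,\ \theta_{ii}=0\ \text{for all } i,\ G(\Theta)\in\mathcal G_1,\ \|\Theta\|_F\le\tfrac12,\ \theta_{ij}\ge\theta\ \text{for all edges } \{i,j\} \text{ of } G(\Theta)\Big\}.$$ The arboricity of $\mathcal G_1$ is $\mathcal R=\min_{G\in\mathcal G_1}\Big\lceil\max_{|V|\ge2}\frac{|E(G_V)|}{|V|-1}\Big\rceil$,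 where $G_V$ is the subgraph of $G$ induced on $V\subseteq\{1,\dots,d\}$. A finite set $\mathcal H$ of graphs is a witnessing set of $\mathcal G_1$ if every $G\in\mathcal G_1$ has a subgraph $H\in\mathcal H$ with $\lceil|E(H)|/(|V(H)|-1)\rceil\ge\mathcal R$. Put $m(\mathcal H)=\min_{H\in\mathcal H}|V(H)|$, $M(\mathcal H)=\log|\mathcal H|/m(\mathcal H)$, $$\hat W_H=\frac1n\sum_{l=1}^n\frac1{|E(H)|}\sum_{\{i,j\}\in E(H)}X_{l,i}X_{l,j},\qquad \psi=\mathbf 1\Big[\max_{H\in\mathcal H}\hat W_H>\frac\kappa4\sqrt{\frac{M(\mathcal H)}{\mathcal R\,n}}\Big].$$ **Theorem.** There is an absolute constant $\kappa_0>0$ such that the following holds for every $\kappa\ge\kappa_0$ and every fixed $\alpha\in(0,1)$. For each $n$ let $d=d_n$, let $\mathcal G_1=\mathcal G_{1,n}$ be a nonempty class of graphs on $\{1,\dots,d_n\}$ not containing the empty graph, let $\mathcal H=\mathcal H_n$ be a witnessing set of $\mathcal G_1$ all of whose members $H$ satisfy $\lceil|E(H)|/(|V(H)|-1)\rceil\ge\mathcal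 R$, and let $\theta=\theta_n\in\mathbb R$. Suppose that $\log|\mathcal H|/n\to0$ as $n\to\infty$ and that $|\mathcal H|\ge2/\alpha$ and $\theta>\kappa\sqrt{M(\mathcal H)/(\mathcal R\,n)}$ for all $n$. Then for all sufficiently large $n$, $$\mathbb P_{0,n}(\psi=1)+\sup_{\Theta\in\mathcal S(\mathcal G_1,\theta)}\mathbb P_{\Theta,n}(\psi=0)\le\alpha,$$ where the supremum over an empty set is read as $0$. -/

import Mathlib

open Filter Topology

noncomputable section

namespace IsingDetection

/-- Spin configurations in `{-1, 1}^d`. -/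
abbrev Config (d : ℕ) : Type := Fin d → ℤˣ

/-- The real value `±1` of the `i`-th spin. -/
def spin {d : ℕ} (x : Config d) (i : Fin d) : ℝ := ((x i : ℤ) : ℝ)

/-- The unnormalised Ising weight `exp (∑_{i,j=1}^d θ_{ij} x_i x_j)`
(the sum runs over ordered pairs). -/
def isingWeight {d : ℕ} (Θ : Matrix (Fin d) (Fin d) ℝ) (x : Config d) : ℝ :=
  Real.exp (∑ i, ∑ j, Θ i j * spin x i * spin x j)

/-- The partition function `Z_Θ`. -/
def partitionFunction {d : ℕ} (Θ : Matrix (Fin d) (Fin d) ℝ) : ℝ :=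
  ∑ x : Config d, isingWeight Θ x

/-- The probability mass function of the zero-field Ising model. -/
def isingPmf {d : ℕ} (Θ : Matrix (Fin d) (Fin d) ℝ) (x : Config d) : ℝ :=
  isingWeight Θ x / partitionFunction Θ

open Classical in
/-- `ℙ_{Θ,n}(A)`: the probability of the event `A` for `n` independent observations from the
Ising model with interaction matrix `Θ`. -/
def sampleProb {d : ℕ} (n : ℕ) (Θ : Matrix (Fin d) (Fin d) ℝ)
    (A : Set (Fin n → Config d)) : ℝ :=
  ∑ x : Fin n → Config d with x ∈ A, ∏ l, isingPmf Θ (x l)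

/-- The graph `G(Θ)` of a symmetric interaction matrix: `i` and `j` are adjacent iff `i ≠ j`
and `θ_{ij} ≠ 0`. -/
def interactionGraph {d : ℕ} (Θ : Matrix (Fin d) (Fin d) ℝ) : SimpleGraph (Fin d) :=
  SimpleGraph.fromRel (fun i j => Θ i j ≠ 0)

/-- The parameter space `S(𝒢, θ)`: symmetric interaction matrices with zero diagonal, graph in
`𝒢`, Frobenius norm at most `1/2`, and all entries along edges at least `θ`. -/
def paramSpace {d : ℕ} (𝒢 : Set (SimpleGraph (Fin d))) (θ : ℝ) :
    Set (Matrix (Fin d) (Fin d) ℝ) :=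
  {Θ | Θ.IsSymm ∧ (∀ i, Θ i i = 0) ∧ interactionGraph Θ ∈ 𝒢 ∧
    √(∑ i, ∑ j, Θ i j ^ 2) ≤ 1 / 2 ∧
    ∀ i j, (interactionGraph Θ).Adj i j → θ ≤ Θ i j}

/-- The number of edges `|E(G)|`. -/
def numEdges {d : ℕ} (G : SimpleGraph (Fin d)) : ℕ := G.edgeSet.ncard

/-- The number `|V(G)|` of non-isolated vertices. -/
def numVerts {d : ℕ} (G : SimpleGraph (Fin d)) : ℕ := G.support.ncard

/-- The arboricity `⌈max_V |E(G_V)| / (|V| - 1)⌉`, the maximum being over vertex sets `V` with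
at least two elements. -/
def arboricity {d : ℕ} (G : SimpleGraph (Fin d)) : ℕ :=
  ⌈⨆ V : {V : Finset (Fin d) // 2 ≤ V.card},
    ((G.induce (V.1 : Set (Fin d))).edgeSet.ncard : ℝ) / ((V.1.card : ℝ) - 1)⌉₊

/-- The arboricity `min_{G ∈ 𝒢} R(G)` of a (nonempty) class of graphs. -/
def classArboricity {d : ℕ} (𝒢 : Set (SimpleGraph (Fin d))) : ℕ :=
  ⨅ G : 𝒢, arboricity G.1

/-- `⌈|E(H)| / (|V(H)| - 1)⌉`. -/
def densityIndex {d : ℕ} (H : SimpleGraph (Fin d)) : ℕ :=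
  ⌈(numEdges H : ℝ) / ((numVerts H : ℝ) - 1)⌉₊

/-- `H` is a witnessing subgraph of `G` with respect to `𝒢`. -/
def IsWitnessing {d : ℕ} (𝒢 : Set (SimpleGraph (Fin d))) (G H : SimpleGraph (Fin d)) : Prop :=
  H ≤ G ∧ classArboricity 𝒢 ≤ densityIndex H

/-- `ℋ` is a witnessing set of `𝒢`. -/
def IsWitnessingSet {d : ℕ} (𝒢 : Set (SimpleGraph (Fin d)))
    (ℋ : Finset (SimpleGraph (Fin d))) : Prop :=
  ∀ G ∈ 𝒢, ∃ H ∈ ℋ, IsWitnessing 𝒢 G H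

/-- `m(ℋ) = min_{H ∈ ℋ} |V(H)|`. -/
def minVerts {d : ℕ} (ℋ : Finset (SimpleGraph (Fin d))) : ℕ :=
  ⨅ H : ℋ, numVerts H.1

/-- `M(ℋ) = log |ℋ| / m(ℋ)`. -/
def scanEntropy {d : ℕ} (ℋ : Finset (SimpleGraph (Fin d))) : ℝ :=
  Real.log ℋ.card / minVerts ℋ

/-- The rate `√(M(ℋ) / (R n))`. -/
def scanRate {d : ℕ} (𝒢 : Set (SimpleGraph (Fin d))) (ℋ : Finset (SimpleGraph (Fin d)))
    (n : ℕ) : ℝ :=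
  √(scanEntropy ℋ / ((classArboricity 𝒢 : ℝ) * n))

open Classical in
/-- The edge-averaged sample correlation `Ŵ_H`. -/
def edgeCorr {d n : ℕ} (H : SimpleGraph (Fin d)) (x : Fin n → Config d) : ℝ :=
  (1 / (n : ℝ)) * ∑ l, ((1 / (numEdges H : ℝ)) *
    ∑ e ∈ H.edgeFinset, Sym2.lift ⟨fun i j => spin (x l) i * spin (x l) j,
      fun _ _ => mul_comm _ _⟩ e)

open Classical in
/-- The scan test `ψ = 1[max_{H ∈ ℋ} Ŵ_H > (κ/4) √(M(ℋ) / (R n))]`. -/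
def scanTest {d n : ℕ} (κ : ℝ) (𝒢 : Set (SimpleGraph (Fin d)))
    (ℋ : Finset (SimpleGraph (Fin d))) (x : Fin n → Config d) : ℕ :=
  if κ / 4 * scanRate 𝒢 ℋ n < ⨆ H : ℋ, edgeCorr H.1 x then 1 else 0

end IsingDetection

end

/-! Both errors are Chernoff bounds for the edge sum S_H = ∑_{ij ∈ E(H)} x_i x_j, and each is at
most 1/|ℋ| ≤ α/2. Density enters through R·m(ℋ) ≤ 4|E(H)|, which gives log|ℋ| ≤ 4n|E(H)|r² for the
scan rate r (`log_card_le_numEdges_mul_scanRate_sq`).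

Under the null, S_H is a Rademacher chaos of order two. Integrating out one spin at a time with cosh
v ≤ exp(v²/2) gives E exp(t S_H) ≤ exp(3t²|E(H)|/2) when t²|E(H)| ≤ 1/8 (`sum_exp_quadratic_le`).
One exceedance then has probability at most |ℋ|⁻², and a union bound finishes.

Under the alternative, take a witness H inside G(Θ). Tilting by exp(-θ S_H) lowers the couplings on
H by θ/2, so its expectation is a ratio of partition functions. By the high-temperature expansion,
Z/∏cosh is monotone in nonnegative couplings (`partitionFunction_mul_prod_cosh_le`); the ratio is
thus at most a quotient of cosh products, hence at most exp(-3θ²|E(H)|/8). The threshold lies below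
θ/4, which leaves exp(-nθ²|E(H)|/8). -/

namespace IsingDetection

/-! ### Exponential moments of a Rademacher chaos -/

/-- Summing a spin configuration on `d + 1` sites over its first spin. -/
theorem sum_config_succ {d : ℕ} (f : Config (d + 1) → ℝ) :
    ∑ x, f x = ∑ y : Config d, (f (Fin.cons 1 y) + f (Fin.cons (-1) y)) := by
  rw [← (Fin.consEquiv fun _ : Fin (d + 1) => ℤˣ).sum_comp, Fintype.sum_prod_type,
    show (Finset.univ : Finset ℤˣ) = {1, -1} from rfl,
    Finset.sum_pair (by decide), ← Finset.sum_add_distrib]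
  rfl

@[simp] theorem spin_cons_zero {d : ℕ} (s : ℤˣ) (y : Config d) :
    spin (Fin.cons s y : Config (d + 1)) 0 = ((s : ℤ) : ℝ) := by
  simp [spin]

@[simp] theorem spin_cons_succ {d : ℕ} (s : ℤˣ) (y : Config d) (i : Fin d) :
    spin (Fin.cons s y : Config (d + 1)) i.succ = spin y i := by
  simp [spin]

/-- The Frobenius norm decreases when a coordinate is integrated out. -/
theorem frobenius_elimination_le {d : ℕ} (C : Fin d → Fin d → ℝ) (u : Fin d → ℝ)
    (h : ∑ i, ∑ j, C i j ^ 2 + (∑ j, u j ^ 2) / 2 ≤ 1 / 16) :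
    ∑ i, ∑ j, (C i j + u i * u j / 2) ^ 2 ≤
      ∑ i, ∑ j, C i j ^ 2 + (9 / 32) * ∑ j, u j ^ 2 := by
  set F := ∑ i, ∑ j, C i j ^ 2
  set β := ∑ j, u j ^ 2
  have hβ : 0 ≤ β := Finset.sum_nonneg fun _ _ => sq_nonneg _
  have hF : 0 ≤ F := Finset.sum_nonneg fun _ _ => Finset.sum_nonneg fun _ _ => sq_nonneg _
  have hββ : ∑ i, ∑ j, (u i * u j) ^ 2 = β ^ 2 := by
    simp only [mul_pow, sq β, β, Finset.sum_mul_sum]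
  have hcs : (∑ i, ∑ j, C i j * (u i * u j)) ^ 2 ≤ F * β ^ 2 := by
    rw [← hββ]
    simp only [F, ← Finset.sum_product', Finset.univ_product_univ]
    exact Finset.sum_mul_sq_le_sq_mul_sq _ _ _
  -- F ≤ 1/16 bounds the cross term by β/4, and β ≤ 1/8 bounds β²/4 by β/32; together they make
  -- 9/32.
  have hcs' : ∑ i, ∑ j, C i j * (u i * u j) ≤ β / 4 := by
    refine abs_le_of_sq_le_sq' ?_ (by positivity) |>.2
    nlinarith [sq_nonneg β]
  have hexp : ∑ i, ∑ j, (C i j + u i * u j / 2) ^ 2 =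
      F + ∑ i, ∑ j, C i j * (u i * u j) + β ^ 2 / 4 := by
    rw [← hββ]
    simp only [F, Finset.sum_div, ← Finset.sum_add_distrib]
    refine Finset.sum_congr rfl fun i _ => Finset.sum_congr rfl fun j _ => by ring
  rw [hexp]
  nlinarith

/-- Subgaussian bound for the exponential moment of a Rademacher chaos of order two. -/
theorem sum_exp_quadratic_le {d : ℕ} (B : Fin d → Fin d → ℝ)
    (hB : ∑ i, ∑ j, B i j ^ 2 ≤ 1 / 16) :
    ∑ x : Config d, Real.exp (∑ i, ∑ j, B i j * spin x i * spin x j) ≤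
      2 ^ d * Real.exp (∑ i, B i i + 3 * ∑ i, ∑ j, B i j ^ 2) := by
  induction d with
  | zero => simp
  | succ d ih =>
    set u : Fin d → ℝ := fun j => B 0 j.succ + B j.succ 0 with hu
    set C : Fin d → Fin d → ℝ := fun i j => B i.succ j.succ with hC
    set β := ∑ j, u j ^ 2 with hβ
    have hFB : ∑ i, ∑ j, C i j ^ 2 + β / 2 ≤ ∑ i, ∑ j, B i j ^ 2 := by
      simp only [Fin.sum_univ_succ, Finset.sum_add_distrib]
      have : β / 2 ≤ ∑ j : Fin d, B 0 j.succ ^ 2 + ∑ j : Fin d, B j.succ 0 ^ 2 := by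
        rw [hβ, Finset.sum_div, ← Finset.sum_add_distrib]
        refine Finset.sum_le_sum fun j _ => ?_
        simp only [hu]
        nlinarith [sq_nonneg (B 0 j.succ - B j.succ 0)]
      nlinarith [sq_nonneg (B 0 0)]
    have hF' := frobenius_elimination_le C u (hFB.trans hB)
    have hβ0 : 0 ≤ β := Finset.sum_nonneg fun _ _ => sq_nonneg _
    have key : ∀ y : Config d,
        Real.exp (∑ i, ∑ j, B i j * spin (Fin.cons 1 y : Config (d + 1)) i *
            spin (Fin.cons 1 y : Config (d + 1)) j) +
          Real.exp (∑ i, ∑ j, B i j * spin (Fin.cons (-1) y : Config (d + 1)) i *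
            spin (Fin.cons (-1) y : Config (d + 1)) j) ≤
        2 * Real.exp (B 0 0) *
          Real.exp (∑ i, ∑ j, (C i j + u i * u j / 2) * spin y i * spin y j) := by
      intro y
      set v := ∑ j, u j * spin y j with hv
      set q := ∑ i, ∑ j, C i j * spin y i * spin y j with hq
      have h1 : ∀ s : ℤˣ, ∑ i, ∑ j, B i j * spin (Fin.cons s y : Config (d + 1)) i *
          spin (Fin.cons s y : Config (d + 1)) j = B 0 0 + ((s : ℤ) : ℝ) * v + q := by
        intro s
        have hs : ((s : ℤ) : ℝ) * ((s : ℤ) : ℝ) = 1 := by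
          rcases Int.units_eq_one_or s with h | h <;> simp [h]
        simp only [Fin.sum_univ_succ, Finset.sum_add_distrib, spin_cons_zero, spin_cons_succ]
        rw [mul_assoc, hs, hv, Finset.mul_sum, hq]
        simp only [hu, add_mul, mul_add, Finset.sum_add_distrib]
        have e1 : ∑ j : Fin d, B 0 j.succ * ((s : ℤ) : ℝ) * spin y j =
          ∑ j : Fin d, ((s : ℤ) : ℝ) * (B 0 j.succ * spin y j) :=
          Finset.sum_congr rfl fun _ _ => by ring
        have e2 : ∑ j : Fin d, B j.succ 0 * spin y j * ((s : ℤ) : ℝ) =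
          ∑ j : Fin d, ((s : ℤ) : ℝ) * (B j.succ 0 * spin y j) :=
          Finset.sum_congr rfl fun _ _ => by ring
        rw [e1, e2]
        ring
      have h2 : ∑ i, ∑ j, (C i j + u i * u j / 2) * spin y i * spin y j = q + v ^ 2 / 2 := by
        rw [sq v, hv, Finset.sum_mul_sum, hq, Finset.sum_div, ← Finset.sum_add_distrib]
        refine Finset.sum_congr rfl fun i _ => ?_
        rw [Finset.sum_div, ← Finset.sum_add_distrib]
        exact Finset.sum_congr rfl fun _ _ => by ring
      rw [h1, h1, h2]
      -- The bound exp(v²/2) is again the exponential of a quadratic form in the remaining spins, so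
      -- the induction closes.
      have h3 := Real.cosh_le_exp_half_sq v
      have h4 : Real.exp (B 0 0 + ((1 : ℤˣ) : ℤ) * v + q) +
          Real.exp (B 0 0 + ((-1 : ℤˣ) : ℤ) * v + q) =
          2 * Real.exp (B 0 0) * (Real.exp q * Real.cosh v) := by
        rw [Real.cosh_eq]
        simp only [Units.val_one, Units.val_neg, Int.cast_one, Int.cast_neg, Real.exp_add]
        ring_nf
      rw [h4, Real.exp_add]
      gcongr
    rw [sum_config_succ]
    refine (Finset.sum_le_sum fun y _ => key y).trans ?_
    rw [← Finset.mul_sum]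
    have hih := ih (fun i j => C i j + u i * u j / 2) (by linarith)
    refine (mul_le_mul_of_nonneg_left hih (by positivity)).trans ?_
    have htr : ∑ i, (C i i + u i * u i / 2) = ∑ i, C i i + β / 2 := by
      rw [hβ, Finset.sum_add_distrib, Finset.sum_div]
      simp only [sq]
    rw [htr, Fin.sum_univ_succ (fun i => B i i)]
    calc 2 * Real.exp (B 0 0) * (2 ^ d * Real.exp (∑ i, C i i + β / 2 +
          3 * ∑ i, ∑ j, (C i j + u i * u j / 2) ^ 2))
        = 2 ^ (d + 1) * Real.exp (B 0 0 + (∑ i, C i i + β / 2 +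
          3 * ∑ i, ∑ j, (C i j + u i * u j / 2) ^ 2)) := by
          rw [Real.exp_add (B 0 0), pow_succ]; ring
      _ ≤ _ := by
          -- The new diagonal costs β/2, while the squared norm drops by at least (1/2 - 9/32)β =
          -- 7β/32; the factor 3 makes the drop pay, as 21/32 ≥ 1/2.
          refine mul_le_mul_of_nonneg_left (Real.exp_le_exp.2 ?_) (by positivity)
          linarith

/-! ### High-temperature expansion and ferromagnetic comparison -/

/-- Monomials in the spins have nonnegative expectation under the uniform law. -/
theorem sum_prod_spin_nonneg {d : ℕ} (S : Finset (Fin d × Fin d)) :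
    0 ≤ ∑ x : Config d, ∏ p ∈ S, (spin x p.1 * spin x p.2) := by
  set χ : Config d → ℝ := fun x => ∏ p ∈ S, (spin x p.1 * spin x p.2) with hχ
  have hmul : ∀ g x : Config d, χ (g * x) = χ g * χ x := by
    intro g x
    simp only [hχ, ← Finset.prod_mul_distrib]
    refine Finset.prod_congr rfl fun p _ => ?_
    simp only [spin, Pi.mul_apply, Units.val_mul, Int.cast_mul]
    ring
  change 0 ≤ ∑ x, χ x
  by_cases h : ∀ x, 0 ≤ χ x
  · exact Finset.sum_nonneg fun x _ => h x
  · push Not at h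
    obtain ⟨g, hg⟩ := h
    -- χ is a character of {±1}^d, so its sum is invariant under translation by g up to the factor χ
    -- g; as χ g < 0, the sum vanishes.
    have h1 : ∑ x, χ x = χ g * ∑ x, χ x := by
      rw [Finset.mul_sum, ← Equiv.sum_comp (Equiv.mulLeft g) χ]
      exact Finset.sum_congr rfl fun x _ => hmul g x
    nlinarith

/-- Monotonicity in the coupling strengths of the high-temperature expansion. -/
theorem sum_prod_one_add_mono {d : ℕ} {s t : Fin d × Fin d → ℝ} (hs : ∀ p, 0 ≤ s p)
    (hst : ∀ p, s p ≤ t p) :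
    ∑ x : Config d, ∏ p, (1 + s p * (spin x p.1 * spin x p.2)) ≤
      ∑ x : Config d, ∏ p, (1 + t p * (spin x p.1 * spin x p.2)) := by
  -- Expanded over sets of pairs, each spin monomial has a coefficient monotone in the couplings and
  -- a nonnegative sum.
  simp only [Finset.prod_one_add, Finset.prod_mul_distrib (f := s),
    Finset.prod_mul_distrib (f := t)]
  rw [Finset.sum_comm, Finset.sum_comm (s := (Finset.univ : Finset (Config d)))]
  refine Finset.sum_le_sum fun S _ => ?_
  rw [← Finset.mul_sum, ← Finset.mul_sum]
  exact mul_le_mul_of_nonneg_right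
    (Finset.prod_le_prod (fun p _ => hs p) fun p _ => hst p) (sum_prod_spin_nonneg S)

theorem exp_mul_eq_cosh_mul_one_add_tanh (a : ℝ) {ε : ℝ} (hε : ε = 1 ∨ ε = -1) :
    Real.exp (a * ε) = Real.cosh a * (1 + Real.tanh a * ε) := by
  have h := (Real.cosh_pos a).ne'
  rw [Real.tanh_eq_sinh_div_cosh]
  rcases hε with rfl | rfl
  · field_simp
    rw [Real.cosh_add_sinh]
  · field_simp
    rw [← sub_eq_add_neg, Real.cosh_sub_sinh]

theorem spin_mul_spin_eq_one_or {d : ℕ} (x : Config d) (i j : Fin d) :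
    spin x i * spin x j = 1 ∨ spin x i * spin x j = -1 := by
  unfold spin
  rcases Int.units_eq_one_or (x i) with h | h <;>
    rcases Int.units_eq_one_or (x j) with h' | h' <;> simp [h, h']

theorem partitionFunction_eq_expansion {d : ℕ} (Θ : Matrix (Fin d) (Fin d) ℝ) :
    partitionFunction Θ = (∏ p : Fin d × Fin d, Real.cosh (Θ p.1 p.2)) *
      ∑ x : Config d, ∏ p : Fin d × Fin d,
        (1 + Real.tanh (Θ p.1 p.2) * (spin x p.1 * spin x p.2)) := by
  unfold partitionFunction isingWeight
  rw [Finset.mul_sum]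
  refine Finset.sum_congr rfl fun x _ => ?_
  rw [← Finset.prod_mul_distrib, ← Fintype.sum_prod_type', Real.exp_sum]
  refine Finset.prod_congr rfl fun p _ => ?_
  rw [mul_assoc, exp_mul_eq_cosh_mul_one_add_tanh _ (spin_mul_spin_eq_one_or x p.1 p.2)]

/-- Comparison of partition functions of ferromagnetic Ising models. -/
theorem partitionFunction_mul_prod_cosh_le {d : ℕ} {Θ' Θ : Matrix (Fin d) (Fin d) ℝ}
    (h0 : ∀ i j, 0 ≤ Θ' i j) (hle : ∀ i j, Θ' i j ≤ Θ i j) :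
    partitionFunction Θ' * ∏ p : Fin d × Fin d, Real.cosh (Θ p.1 p.2) ≤
      partitionFunction Θ * ∏ p : Fin d × Fin d, Real.cosh (Θ' p.1 p.2) := by
  rw [partitionFunction_eq_expansion Θ, partitionFunction_eq_expansion Θ']
  have h := sum_prod_one_add_mono (s := fun p : Fin d × Fin d => Real.tanh (Θ' p.1 p.2))
    (t := fun p : Fin d × Fin d => Real.tanh (Θ p.1 p.2))
    (fun p => by
      rw [Real.tanh_eq_sinh_div_cosh]
      exact div_nonneg (Real.sinh_nonneg_iff.2 (h0 _ _)) (Real.cosh_pos _).le)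
    (fun p => by
      rw [Real.tanh_eq_sinh_div_cosh, Real.tanh_eq_sinh_div_cosh,
        div_le_div_iff₀ (Real.cosh_pos _) (Real.cosh_pos _)]
      have := Real.sinh_nonneg_iff.2 (sub_nonneg.2 (hle p.1 p.2))
      rw [Real.sinh_sub] at this
      linarith)
  have hc : ∀ Ψ : Matrix (Fin d) (Fin d) ℝ, 0 ≤ ∏ p : Fin d × Fin d, Real.cosh (Ψ p.1 p.2) :=
    fun Ψ => Finset.prod_nonneg fun p _ => (Real.cosh_pos _).le
  have := mul_le_mul_of_nonneg_left h (mul_nonneg (hc Θ) (hc Θ'))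
  linarith

/-- The ratio cosh a / cosh (a - b) = cosh b + tanh (a - b) sinh b is smallest at a = 2b, where it
is cosh 2b / cosh b ≥ 1 + b². This is the gain per ordered pair when a coupling a is lowered by b.
-/
theorem cosh_sub_mul_exp_le_cosh {a b : ℝ} (hb : 0 ≤ b) (hb' : b ≤ 1 / 4) (hab : 2 * b ≤ a) :
    Real.cosh (a - b) * Real.exp (3 / 4 * b ^ 2) ≤ Real.cosh a := by
  have hb2 : b ^ 2 ≤ 1 / 16 := by nlinarith
  have h1 : Real.exp (3 / 4 * b ^ 2) ≤ 1 + b ^ 2 := by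
    have := Real.one_sub_le_exp_neg (3 / 4 * b ^ 2)
    rw [Real.exp_neg] at this
    have hpos := Real.exp_pos (3 / 4 * b ^ 2)
    have h2 : (1 - 3 / 4 * b ^ 2) * Real.exp (3 / 4 * b ^ 2) ≤ 1 := by
      calc _ ≤ (Real.exp (3 / 4 * b ^ 2))⁻¹ * Real.exp (3 / 4 * b ^ 2) := by gcongr
        _ = 1 := inv_mul_cancel₀ hpos.ne'
    have h3 : 1 ≤ (1 - 3 / 4 * b ^ 2) * (1 + b ^ 2) := by nlinarith [sq_nonneg b]
    exact le_of_mul_le_mul_left (h2.trans h3) (by linarith)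
  have hcb := Real.one_le_cosh b
  have hcab := Real.cosh_pos (a - b)
  have h4 : Real.cosh a = Real.cosh (a - b) * Real.cosh b + Real.sinh (a - b) * Real.sinh b := by
    rw [← Real.cosh_add, sub_add_cancel]
  have h5 : 0 ≤ Real.sinh (a - b) * Real.cosh b - Real.cosh (a - b) * Real.sinh b := by
    rw [← Real.sinh_sub]
    exact Real.sinh_nonneg_iff.2 (by linarith)
  have hsb : b ≤ Real.sinh b := Real.self_le_sinh_iff.2 hb
  have hsq := Real.cosh_sq b
  have h6 : Real.cosh (a - b) * (1 + b ^ 2) * Real.cosh b ≤ Real.cosh a * Real.cosh b := by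
    have h7 : Real.cosh (a - b) * (Real.cosh b ^ 2 + Real.sinh b ^ 2) ≤
        Real.cosh a * Real.cosh b := by
      rw [h4]
      nlinarith [mul_nonneg h5 (hb.trans hsb)]
    refine le_trans ?_ h7
    rw [mul_assoc]
    refine mul_le_mul_of_nonneg_left ?_ hcab.le
    have : b ^ 2 ≤ Real.sinh b ^ 2 := by gcongr
    have hc : 1 + 2 / 5 * b ^ 2 ≤ Real.cosh b := by
      refine (abs_le_of_sq_le_sq' ?_ (by linarith)).2
      nlinarith [sq_nonneg b]
    nlinarith [mul_nonneg (sub_nonneg.2 hc) (show 0 ≤ 3 - b ^ 2 by linarith),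
      sq_nonneg (Real.cosh b - 1), sq_nonneg b, mul_nonneg (sq_nonneg b) (sub_nonneg.2 hb2)]
  exact (mul_le_mul_of_nonneg_left h1 hcab.le).trans (le_of_mul_le_mul_right h6 (by linarith))

/-! ### Edge sums as quadratic forms -/

open Classical in
/-- The sum of the products of the spins over the edges of `H`. -/
noncomputable def edgeSum {d : ℕ} (H : SimpleGraph (Fin d)) (x : Config d) : ℝ :=
  ∑ e ∈ H.edgeFinset, Sym2.lift ⟨fun i j => spin x i * spin x j, fun _ _ => mul_comm _ _⟩ e

theorem edgeCorr_eq {d n : ℕ} (H : SimpleGraph (Fin d)) (x : Fin n → Config d) :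
    edgeCorr H x = (∑ l, edgeSum H (x l)) / (n * numEdges H) := by
  have : edgeCorr H x = (1 / (n : ℝ)) * ∑ l, (1 / (numEdges H : ℝ)) * edgeSum H (x l) := rfl
  rw [this, ← Finset.mul_sum]
  field_simp

-- Each edge is the image of exactly two ordered pairs; this is the factor between the Hamiltonian
-- and edge sums.
open Classical in
theorem sum_adj_eq_two_mul_sum_edgeFinset {d : ℕ} (H : SimpleGraph (Fin d))
    (f : Sym2 (Fin d) → ℝ) :
    ∑ i, ∑ j, (if H.Adj i j then f s(i, j) else 0) = 2 * ∑ e ∈ H.edgeFinset, f e := by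
  rw [← Fintype.sum_prod_type' (f := fun i j => if H.Adj i j then f s(i, j) else 0),
    ← Finset.sum_filter,
    ← Finset.sum_fiberwise_of_maps_to (t := H.edgeFinset) (g := fun p => s(p.1, p.2))
      (by simp), Finset.mul_sum]
  refine Finset.sum_congr rfl fun e he => ?_
  induction e with
  | _ v w =>
    have hvw : H.Adj v w := by simpa using he
    have : (Finset.univ.filter fun p : Fin d × Fin d => H.Adj p.1 p.2).filter
        (fun p => s(p.1, p.2) = s(v, w)) = {(v, w), (w, v)} := by
      ext ⟨a, b⟩
      simp only [Finset.mem_filter, Finset.mem_univ, true_and, Sym2.eq_iff, Finset.mem_insert,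
        Finset.mem_singleton, Prod.mk.injEq]
      constructor
      · exact fun h => h.2
      · rintro (⟨rfl, rfl⟩ | ⟨rfl, rfl⟩)
        · exact ⟨hvw, by simp⟩
        · exact ⟨hvw.symm, by simp⟩
    rw [this, Finset.sum_pair (by simp [hvw.ne]), Sym2.eq_swap (a := w)]
    ring

open Classical in
theorem numEdges_eq_card {d : ℕ} (H : SimpleGraph (Fin d)) :
    numEdges H = H.edgeFinset.card := by
  rw [numEdges, ← SimpleGraph.coe_edgeFinset, Set.ncard_coe_finset]

open Classical in
theorem sum_adj_const {d : ℕ} (H : SimpleGraph (Fin d)) (c : ℝ) :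
    ∑ i, ∑ j, (if H.Adj i j then c else 0) = 2 * numEdges H * c := by
  rw [sum_adj_eq_two_mul_sum_edgeFinset H fun _ => c, Finset.sum_const, numEdges_eq_card,
    nsmul_eq_mul]
  ring

open Classical in
theorem sum_adj_mul_spin {d : ℕ} (H : SimpleGraph (Fin d)) (c : ℝ) (x : Config d) :
    ∑ i, ∑ j, (if H.Adj i j then c else 0) * spin x i * spin x j = 2 * c * edgeSum H x := by
  have h := sum_adj_eq_two_mul_sum_edgeFinset H
    (Sym2.lift ⟨fun i j => spin x i * spin x j, fun _ _ => mul_comm _ _⟩)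
  rw [edgeSum, mul_right_comm, ← h, Finset.sum_mul]
  refine Finset.sum_congr rfl fun i _ => ?_
  rw [Finset.sum_mul]
  refine Finset.sum_congr rfl fun j _ => ?_
  split_ifs
  · simp
    ring
  · simp

theorem partitionFunction_pos {d : ℕ} (Θ : Matrix (Fin d) (Fin d) ℝ) :
    0 < partitionFunction Θ :=
  Finset.sum_pos (fun _ _ => Real.exp_pos _) ⟨fun _ => 1, Finset.mem_univ _⟩

theorem isingPmf_nonneg {d : ℕ} (Θ : Matrix (Fin d) (Fin d) ℝ) (x : Config d) :
    0 ≤ isingPmf Θ x :=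
  div_nonneg (Real.exp_pos _).le (partitionFunction_pos Θ).le

theorem isingPmf_zero {d : ℕ} (x : Config d) :
    isingPmf (0 : Matrix (Fin d) (Fin d) ℝ) x = (2 ^ d)⁻¹ := by
  simp [isingPmf, isingWeight, partitionFunction]

/-! ### Exponential moments of edge sums -/

/-- Exponential moments of the edge sum under the uniform law. -/
theorem sum_isingPmf_zero_mul_exp_le {d : ℕ} (H : SimpleGraph (Fin d)) (t : ℝ)
    (ht : t ^ 2 * numEdges H ≤ 1 / 8) :
    ∑ x : Config d, isingPmf 0 x * Real.exp (t * edgeSum H x) ≤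
      Real.exp (3 / 2 * (t ^ 2 * numEdges H)) := by
  classical
  have hF : ∑ i, ∑ j, (if H.Adj i j then t / 2 else 0) ^ 2 = t ^ 2 * numEdges H / 2 := by
    simp only [ite_pow]
    rw [zero_pow two_ne_zero, sum_adj_const]
    ring
  have h := sum_exp_quadratic_le (fun i j => if H.Adj i j then t / 2 else 0)
    (by rw [hF]; linarith)
  simp only [sum_adj_mul_spin, hF, SimpleGraph.irrefl, if_false, Finset.sum_const_zero,
    zero_add] at h
  simp only [isingPmf_zero, ← Finset.mul_sum]
  rw [inv_mul_le_iff₀ (by positivity)]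
  refine le_trans (le_of_eq ?_) (h.trans (le_of_eq ?_))
  · exact Finset.sum_congr rfl fun x _ => by congr 1; ring
  · congr 2; ring

/-- Exponential moments of the edge sum of a subgraph under a ferromagnetic Ising model. -/
theorem sum_isingPmf_mul_exp_neg_le {d : ℕ} {Θ : Matrix (Fin d) (Fin d) ℝ}
    {H : SimpleGraph (Fin d)} {θ : ℝ} (hθ : 0 ≤ θ) (hθ' : θ ≤ 1 / 2)
    (hΘ : ∀ i j, 0 ≤ Θ i j) (hH : ∀ i j, H.Adj i j → θ ≤ Θ i j) :
    ∑ x : Config d, isingPmf Θ x * Real.exp (-(θ * edgeSum H x)) ≤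
      Real.exp (-(3 / 8 * (θ ^ 2 * numEdges H))) := by
  classical
  -- Lowering by θ/2 per ordered pair produces exactly the tilt θ per edge. The result stays
  -- ferromagnetic, and Θ i j ≥ 2(θ/2) on H, as the cosh estimate requires.
  set Θ' : Matrix (Fin d) (Fin d) ℝ := fun i j => Θ i j - if H.Adj i j then θ / 2 else 0
    with hΘ'
  have hw : ∀ x : Config d,
      isingWeight Θ' x = isingWeight Θ x * Real.exp (-(θ * edgeSum H x)) := by
    intro x
    rw [isingWeight, isingWeight, ← Real.exp_add]
    congr 1
    simp only [hΘ', sub_mul, Finset.sum_sub_distrib, sum_adj_mul_spin]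
    ring
  have hZ : ∑ x : Config d, isingPmf Θ x * Real.exp (-(θ * edgeSum H x)) =
      partitionFunction Θ' / partitionFunction Θ := by
    rw [partitionFunction, Finset.sum_div]
    refine Finset.sum_congr rfl fun x _ => ?_
    rw [hw, isingPmf]
    ring
  have hcmp := partitionFunction_mul_prod_cosh_le (Θ' := Θ') (Θ := Θ)
    (fun i j => by
      simp only [hΘ']
      split_ifs with h
      · linarith [hH i j h]
      · linarith [hΘ i j])
    (fun i j => by
      simp only [hΘ']
      split_ifs <;> linarith)
  set s := 3 / 8 * (θ ^ 2 * numEdges H) with hs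
  have hprod : (∏ p : Fin d × Fin d, Real.cosh (Θ' p.1 p.2)) * Real.exp s ≤
      ∏ p : Fin d × Fin d, Real.cosh (Θ p.1 p.2) := by
    have hse : s = ∑ p : Fin d × Fin d, if H.Adj p.1 p.2 then 3 / 4 * (θ / 2) ^ 2 else 0 := by
      rw [Fintype.sum_prod_type, sum_adj_const, hs]
      ring
    rw [hse, Real.exp_sum, ← Finset.prod_mul_distrib]
    refine Finset.prod_le_prod (fun p _ => by positivity) fun p _ => ?_
    simp only [hΘ']
    split_ifs with h
    · exact cosh_sub_mul_exp_le_cosh (by linarith) (by linarith) (by linarith [hH _ _ h])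
    · simp
  have hP : 0 < ∏ p : Fin d × Fin d, Real.cosh (Θ' p.1 p.2) :=
    Finset.prod_pos fun p _ => Real.cosh_pos _
  rw [hZ, Real.exp_neg, div_le_iff₀ (partitionFunction_pos Θ), ← div_eq_inv_mul,
    le_div_iff₀ (Real.exp_pos s)]
  have h1 := mul_le_mul_of_nonneg_left hprod (partitionFunction_pos Θ').le
  refine le_of_mul_le_mul_right ?_ hP
  linarith

/-! ### Chernoff and union bounds -/

/-- Chernoff's bound for `n` independent observations. -/
theorem sampleProb_le_exp_mul_pow {d n : ℕ} (Θ : Matrix (Fin d) (Fin d) ℝ)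
    (A : Set (Fin n → Config d)) (f : Config d → ℝ) (c : ℝ)
    (hA : ∀ x ∈ A, c ≤ ∑ l, f (x l)) :
    sampleProb n Θ A ≤ Real.exp (-c) * (∑ x, isingPmf Θ x * Real.exp (f x)) ^ n := by
  classical
  rw [Fintype.sum_pow, Finset.mul_sum, sampleProb]
  refine (Finset.sum_le_sum fun x hx => ?_).trans
    (Finset.sum_le_sum_of_subset_of_nonneg (Finset.subset_univ _) fun x _ _ => ?_)
  · rw [Finset.prod_mul_distrib, ← Real.exp_sum, mul_left_comm, ← Real.exp_add]
    refine le_mul_of_one_le_right (Finset.prod_nonneg fun l _ => isingPmf_nonneg Θ _) ?_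
    refine Real.one_le_exp ?_
    linarith [hA x (Finset.mem_filter.1 hx).2]
  · exact mul_nonneg (Real.exp_pos _).le (Finset.prod_nonneg fun l _ =>
      mul_nonneg (isingPmf_nonneg Θ _) (Real.exp_pos _).le)

theorem sampleProb_le_sum {d n : ℕ} {ι : Type*} (Θ : Matrix (Fin d) (Fin d) ℝ)
    (A : Set (Fin n → Config d)) (s : Finset ι) (B : ι → Set (Fin n → Config d))
    (hA : ∀ x ∈ A, ∃ i ∈ s, x ∈ B i) :
    sampleProb n Θ A ≤ ∑ i ∈ s, sampleProb n Θ (B i) := by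
  classical
  have hp : ∀ x : Fin n → Config d, 0 ≤ ∏ l, isingPmf Θ (x l) := fun x =>
    Finset.prod_nonneg fun l _ => isingPmf_nonneg Θ _
  simp only [sampleProb, Finset.sum_filter]
  rw [Finset.sum_comm]
  refine Finset.sum_le_sum fun x _ => ?_
  have h0 : ∀ i ∈ s, 0 ≤ if x ∈ B i then ∏ l, isingPmf Θ (x l) else 0 := fun i _ => by
    split_ifs
    exacts [hp x, le_rfl]
  split_ifs with hx
  · obtain ⟨i, hi, hxi⟩ := hA x hx
    refine le_trans ?_ (Finset.single_le_sum h0 hi)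
    rw [if_pos hxi]
  · exact Finset.sum_nonneg h0

/-! ### Arboricity, edge counts and the scan rate -/

theorem one_le_arboricity {d : ℕ} {G : SimpleGraph (Fin d)} (hG : G ≠ ⊥) :
    1 ≤ arboricity G := by
  classical
  obtain ⟨a, b, hab⟩ := SimpleGraph.ne_bot_iff_exists_adj.1 hG
  have hcard : ({a, b} : Finset (Fin d)).card = 2 := Finset.card_pair hab.ne
  refine Nat.one_le_iff_ne_zero.2 (Nat.ceil_pos.2 ?_).ne'
  refine lt_of_lt_of_le ?_ (le_ciSup (Set.finite_range _).bddAbove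
    (⟨{a, b}, hcard.ge⟩ : {V : Finset (Fin d) // 2 ≤ V.card}))
  simp only [hcard]
  have : 0 < (G.induce (({a, b} : Finset (Fin d)) : Set (Fin d))).edgeSet.ncard := by
    rw [Set.ncard_pos]
    exact ⟨s(⟨a, by simp⟩, ⟨b, by simp⟩), by simpa using hab⟩
  have : (0 : ℝ) < (G.induce (({a, b} : Finset (Fin d)) : Set (Fin d))).edgeSet.ncard := by
    exact_mod_cast this
  norm_num
  exact_mod_cast this

theorem one_le_classArboricity {d : ℕ} {𝒢 : Set (SimpleGraph (Fin d))} (h : 𝒢.Nonempty)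
    (hbot : ⊥ ∉ 𝒢) : 1 ≤ classArboricity 𝒢 := by
  have : Nonempty 𝒢 := h.to_subtype
  exact le_ciInf fun G => one_le_arboricity fun hG => hbot (hG ▸ G.2)

theorem numVerts_le_two_mul_numEdges {d : ℕ} (H : SimpleGraph (Fin d)) :
    numVerts H ≤ 2 * numEdges H := by
  classical
  rw [numEdges_eq_card, ← SimpleGraph.sum_degrees_support_eq_twice_card_edges, numVerts,
    Set.ncard_eq_toFinset_card', Finset.card_eq_sum_ones]
  refine Finset.sum_le_sum fun v hv => ?_
  exact (H.degree_pos_iff_mem_support v).2 (Set.mem_toFinset.1 hv)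

/-- The number of edges is at least of the order of the density index times the number of
vertices. -/
theorem mul_numVerts_le_four_mul_numEdges {d R : ℕ} {H : SimpleGraph (Fin d)} (hR : 1 ≤ R)
    (hH : R ≤ densityIndex H) :
    2 ≤ numVerts H ∧ (R : ℝ) * numVerts H ≤ 4 * numEdges H := by
  have hpos : 0 < (numEdges H : ℝ) / ((numVerts H : ℝ) - 1) :=
    Nat.ceil_pos.1 (lt_of_lt_of_le hR hH)
  have hE0 : (0 : ℝ) ≤ numEdges H := Nat.cast_nonneg _
  -- With at most one vertex the quotient would be nonpositive (division by zero gives 0),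
  -- contradicting R ≥ 1.
  have hV1 : 0 < (numVerts H : ℝ) - 1 := by
    by_contra hneg
    exact absurd (div_nonpos_of_nonneg_of_nonpos hE0 (not_lt.1 hneg)) (not_le.2 hpos)
  have hV2 : 2 ≤ numVerts H := by
    have : (1 : ℝ) < numVerts H := by linarith
    exact_mod_cast this
  refine ⟨hV2, ?_⟩
  have hV2' : (2 : ℝ) ≤ numVerts H := by exact_mod_cast hV2
  -- The ceiling yields only |E| > (R - 1)(|V| - 1). This is at least R|V|/4 when R, |V| ≥ 2 but
  -- empty when R = 1, where the degree sum gives |V| ≤ 2|E|.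
  rcases Nat.eq_or_lt_of_le hR with h1 | h2
  · rw [← h1]
    have : (numVerts H : ℝ) ≤ 2 * numEdges H := by
      exact_mod_cast numVerts_le_two_mul_numEdges H
    push_cast
    linarith
  · have hR2 : (2 : ℝ) ≤ R := by exact_mod_cast h2
    have hlt : (R : ℝ) - 1 < (numEdges H : ℝ) / ((numVerts H : ℝ) - 1) := by
      have : R - 1 < densityIndex H := by omega
      have := Nat.lt_ceil.1 this
      rwa [Nat.cast_sub hR, Nat.cast_one] at this
    rw [lt_div_iff₀ hV1] at hlt
    nlinarith [mul_nonneg (sub_nonneg.2 hR2) (sub_nonneg.2 hV2')]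

theorem minVerts_le {d : ℕ} {ℋ : Finset (SimpleGraph (Fin d))} {H : SimpleGraph (Fin d)}
    (hH : H ∈ ℋ) : minVerts ℋ ≤ numVerts H :=
  ciInf_le (OrderBot.bddBelow _) (⟨H, hH⟩ : ℋ)

/-- The edge counts in a witnessing set, in terms of the scan rate. -/
theorem log_card_le_numEdges_mul_scanRate_sq {d n : ℕ} (hn : 0 < n)
    {𝒢 : Set (SimpleGraph (Fin d))} {ℋ : Finset (SimpleGraph (Fin d))}
    (hR : 1 ≤ classArboricity 𝒢) (hℋ : ∀ H ∈ ℋ, classArboricity 𝒢 ≤ densityIndex H)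
    {H : SimpleGraph (Fin d)} (hH : H ∈ ℋ) :
    Real.log ℋ.card ≤ 4 * (n * numEdges H * scanRate 𝒢 ℋ n ^ 2) := by
  obtain ⟨-, hE⟩ := mul_numVerts_le_four_mul_numEdges hR (hℋ H hH)
  have hm2 : 2 ≤ minVerts ℋ := by
    have : Nonempty ℋ := ⟨⟨H, hH⟩⟩
    exact le_ciInf fun K => (mul_numVerts_le_four_mul_numEdges hR (hℋ K.1 K.2)).1
  have hm0 : (0 : ℝ) < minVerts ℋ := by exact_mod_cast (by omega : 0 < minVerts ℋ)
  have hR0 : (0 : ℝ) < classArboricity 𝒢 := by exact_mod_cast hR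
  have hn0 : (0 : ℝ) < n := by exact_mod_cast hn
  have hL : 0 ≤ Real.log ℋ.card := Real.log_natCast_nonneg _
  have hmV : (minVerts ℋ : ℝ) ≤ numVerts H := by exact_mod_cast minVerts_le hH
  rw [scanRate, scanEntropy, Real.sq_sqrt (by positivity)]
  have h1 : (classArboricity 𝒢 : ℝ) * minVerts ℋ ≤ 4 * numEdges H :=
    (mul_le_mul_of_nonneg_left hmV hR0.le).trans hE
  have h2 : 4 * (n * numEdges H * (Real.log ℋ.card / minVerts ℋ / (classArboricity 𝒢 * n))) =
      Real.log ℋ.card * (4 * numEdges H / (classArboricity 𝒢 * minVerts ℋ)) := by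
    field_simp
  rw [h2]
  exact le_mul_of_one_le_right hL ((one_le_div (by positivity)).2 h1)

/-! ### The two error probabilities -/

theorem scanTest_eq_one {d n : ℕ} {κ : ℝ} {𝒢 : Set (SimpleGraph (Fin d))}
    {ℋ : Finset (SimpleGraph (Fin d))} (hℋ : ℋ.Nonempty) {x : Fin n → Config d}
    (h : scanTest κ 𝒢 ℋ x = 1) : ∃ H ∈ ℋ, κ / 4 * scanRate 𝒢 ℋ n < edgeCorr H x := by
  have : Nonempty ℋ := hℋ.to_subtype
  by_contra! hle
  have hsup : ⨆ H : ℋ, edgeCorr H.1 x ≤ κ / 4 * scanRate 𝒢 ℋ n :=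
    ciSup_le fun H => hle H.1 H.2
  simp [scanTest, not_lt.2 hsup] at h

theorem scanTest_eq_zero {d n : ℕ} {κ : ℝ} {𝒢 : Set (SimpleGraph (Fin d))}
    {ℋ : Finset (SimpleGraph (Fin d))} {x : Fin n → Config d}
    (h : scanTest κ 𝒢 ℋ x = 0) {H : SimpleGraph (Fin d)} (hH : H ∈ ℋ) :
    edgeCorr H x ≤ κ / 4 * scanRate 𝒢 ℋ n := by
  by_contra! hlt
  have hsup : κ / 4 * scanRate 𝒢 ℋ n < ⨆ H : ℋ, edgeCorr H.1 x :=
    hlt.trans_le (le_ciSup (f := fun H : ℋ => edgeCorr H.1 x) (Set.finite_range _).bddAbove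
      ⟨H, hH⟩)
  simp [scanTest, hsup] at h

theorem numEdges_pos {d R : ℕ} {H : SimpleGraph (Fin d)} (hR : 1 ≤ R)
    (hH : R ≤ densityIndex H) : (0 : ℝ) < numEdges H := by
  obtain ⟨hV, -⟩ := mul_numVerts_le_four_mul_numEdges hR hH
  have := numVerts_le_two_mul_numEdges H
  exact_mod_cast (by omega : 0 < numEdges H)

/-- Deviation of a single edge-averaged correlation under the null hypothesis. -/
theorem sampleProb_zero_edgeCorr_gt_le {d n : ℕ} (hn : 0 < n) {κ : ℝ} (hκ : 28 ≤ κ)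
    {𝒢 : Set (SimpleGraph (Fin d))} {ℋ : Finset (SimpleGraph (Fin d))}
    (hR : 1 ≤ classArboricity 𝒢) (hℋ : ∀ H ∈ ℋ, classArboricity 𝒢 ≤ densityIndex H)
    (hL : Real.log ℋ.card / n ≤ 1 / 8) {H : SimpleGraph (Fin d)} (hH : H ∈ ℋ) :
    sampleProb n 0 {x | κ / 4 * scanRate 𝒢 ℋ n < edgeCorr H x} ≤
      Real.exp (-(2 * Real.log ℋ.card)) := by
  have hE := numEdges_pos hR (hℋ H hH)
  have hn0 : (0 : ℝ) < n := by exact_mod_cast hn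
  have hlog := log_card_le_numEdges_mul_scanRate_sq hn hR hℋ hH
  set L := Real.log ℋ.card
  set E : ℝ := (numEdges H : ℝ) with hEdef
  set r := scanRate 𝒢 ℋ n
  have hr : 0 ≤ r := Real.sqrt_nonneg _
  have hL0 : 0 ≤ L := Real.log_natCast_nonneg _
  -- With this tilt the n-fold moment costs 3L/2 and the threshold gains at least κL/8. Since 28/8 =
  -- 3/2 + 2, the remainder is 2L.
  set t := √(L / (n * E)) with ht
  have ht0 : 0 ≤ t := Real.sqrt_nonneg _
  have ht2 : t ^ 2 = L / (n * E) := Real.sq_sqrt (by positivity)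
  have htE : t ^ 2 * E = L / n := by
    rw [ht2]
    field_simp
  have hdev : κ / 8 * L ≤ t * (n * E * (κ / 4 * r)) := by
    refine (abs_le_of_sq_le_sq' ?_ (by positivity)).2
    have h1 : (t * (n * E * (κ / 4 * r))) ^ 2 = κ ^ 2 / 64 * (L * (4 * (n * E * r ^ 2))) := by
      rw [mul_pow, ht2]
      field_simp
      ring
    rw [h1]
    have := mul_le_mul_of_nonneg_left (mul_le_mul_of_nonneg_left hlog hL0)
      (by positivity : 0 ≤ κ ^ 2 / 64)
    linarith
  refine (sampleProb_le_exp_mul_pow 0 _ (fun x => t * edgeSum H x)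
    (t * (n * E * (κ / 4 * r))) fun x hx => ?_).trans ?_
  · rw [← Finset.mul_sum]
    refine mul_le_mul_of_nonneg_left ?_ ht0
    have hx' : κ / 4 * r < edgeCorr H x := hx
    rw [edgeCorr_eq, ← hEdef, lt_div_iff₀ (by positivity)] at hx'
    linarith
  · have hmgf := sum_isingPmf_zero_mul_exp_le H t (by rw [← hEdef, htE]; exact hL)
    rw [← hEdef, htE] at hmgf
    calc _ ≤ Real.exp (-(t * (n * E * (κ / 4 * r)))) * Real.exp (3 / 2 * (L / n)) ^ n := by
          refine mul_le_mul_of_nonneg_left (pow_le_pow_left₀ ?_ hmgf n) (Real.exp_pos _).le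
          exact Finset.sum_nonneg fun x _ =>
            mul_nonneg (isingPmf_nonneg 0 x) (Real.exp_pos _).le
      _ = Real.exp (-(t * (n * E * (κ / 4 * r))) + 3 / 2 * L) := by
          rw [← Real.exp_nat_mul, ← Real.exp_add]
          congr 2
          field_simp
      _ ≤ _ := Real.exp_le_exp.2 (by nlinarith)

theorem exp_neg_log_card {ι : Type*} {s : Finset ι} (hs : s.Nonempty) :
    Real.exp (-Real.log s.card) = (s.card : ℝ)⁻¹ := by
  rw [Real.exp_neg, Real.exp_log (by exact_mod_cast hs.card_pos)]

/-- Bound for the type I error of the scan test. -/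
theorem sampleProb_zero_scanTest_le {d n : ℕ} (hn : 0 < n) {κ : ℝ} (hκ : 28 ≤ κ)
    {𝒢 : Set (SimpleGraph (Fin d))} {ℋ : Finset (SimpleGraph (Fin d))} (hne : ℋ.Nonempty)
    (hR : 1 ≤ classArboricity 𝒢) (hℋ : ∀ H ∈ ℋ, classArboricity 𝒢 ≤ densityIndex H)
    (hL : Real.log ℋ.card / n ≤ 1 / 8) :
    sampleProb n (0 : Matrix (Fin d) (Fin d) ℝ) {x | scanTest κ 𝒢 ℋ x = 1} ≤
      (ℋ.card : ℝ)⁻¹ := by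
  refine (sampleProb_le_sum 0 _ ℋ (fun H => {x | κ / 4 * scanRate 𝒢 ℋ n < edgeCorr H x})
    fun x hx => scanTest_eq_one hne hx).trans ?_
  refine (Finset.sum_le_sum fun H hH =>
    sampleProb_zero_edgeCorr_gt_le hn hκ hR hℋ hL hH).trans (le_of_eq ?_)
  have hc : (ℋ.card : ℝ) ≠ 0 := by exact_mod_cast hne.card_pos.ne'
  rw [Finset.sum_const, nsmul_eq_mul, two_mul, neg_add, Real.exp_add, exp_neg_log_card hne,
    mul_inv_cancel_left₀ hc]

theorem paramSpace_nonneg {d : ℕ} {𝒢 : Set (SimpleGraph (Fin d))} {θ : ℝ} (hθ : 0 ≤ θ)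
    {Θ : Matrix (Fin d) (Fin d) ℝ} (hΘ : Θ ∈ paramSpace 𝒢 θ) (i j : Fin d) : 0 ≤ Θ i j := by
  obtain ⟨-, hdiag, -, -, hedge⟩ := hΘ
  by_cases hij : i = j
  · rw [hij, hdiag]
  by_cases h0 : Θ i j = 0
  · rw [h0]
  · exact hθ.trans (hedge i j ((SimpleGraph.fromRel_adj _ _ _).2 ⟨hij, Or.inl h0⟩))

/-- A single entry is dominated by the Frobenius norm. This yields θ ≤ 1/2, the range needed in the
tilted moment bound. -/
theorem paramSpace_entry_le {d : ℕ} {𝒢 : Set (SimpleGraph (Fin d))} {θ : ℝ}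
    {Θ : Matrix (Fin d) (Fin d) ℝ} (hΘ : Θ ∈ paramSpace 𝒢 θ) (i j : Fin d) :
    Θ i j ≤ 1 / 2 := by
  obtain ⟨-, -, -, hF, -⟩ := hΘ
  refine le_trans (Real.le_sqrt_of_sq_le ?_) hF
  refine le_trans ?_ (Finset.single_le_sum (f := fun i => ∑ j, Θ i j ^ 2)
    (fun i _ => Finset.sum_nonneg fun j _ => sq_nonneg _) (Finset.mem_univ i))
  exact Finset.single_le_sum (f := fun j => Θ i j ^ 2) (fun j _ => sq_nonneg _)
    (Finset.mem_univ j)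

/-- Bound for the type II error of the scan test. -/
theorem sampleProb_scanTest_eq_zero_le {d n : ℕ} (hn : 0 < n) {κ : ℝ} (hκ : 28 ≤ κ)
    {𝒢 : Set (SimpleGraph (Fin d))} {ℋ : Finset (SimpleGraph (Fin d))} (hne : ℋ.Nonempty)
    (hR : 1 ≤ classArboricity 𝒢) (hℋ : ∀ H ∈ ℋ, classArboricity 𝒢 ≤ densityIndex H)
    (hwit : IsWitnessingSet 𝒢 ℋ) {θ : ℝ} (hθ : κ * scanRate 𝒢 ℋ n < θ)
    {Θ : Matrix (Fin d) (Fin d) ℝ} (hΘ : Θ ∈ paramSpace 𝒢 θ) :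
    sampleProb n Θ {x | scanTest κ 𝒢 ℋ x = 0} ≤ (ℋ.card : ℝ)⁻¹ := by
  obtain ⟨H, hH, hHG, -⟩ := hwit _ hΘ.2.2.1
  have hE := numEdges_pos hR (hℋ H hH)
  have hn0 : (0 : ℝ) < n := by exact_mod_cast hn
  have hlog := log_card_le_numEdges_mul_scanRate_sq hn hR hℋ hH
  have hr : 0 ≤ scanRate 𝒢 ℋ n := Real.sqrt_nonneg _
  have hκr : 0 ≤ κ * scanRate 𝒢 ℋ n := by positivity
  have hθ0 : 0 ≤ θ := hκr.trans hθ.le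
  have hedge : ∀ i j, H.Adj i j → θ ≤ Θ i j := fun i j h => hΘ.2.2.2.2 i j (hHG h)
  have hθ' : θ ≤ 1 / 2 := by
    have hbot : H ≠ ⊥ := by
      rintro rfl
      simp [numEdges] at hE
    obtain ⟨i, j, hij⟩ := SimpleGraph.ne_bot_iff_exists_adj.1 hbot
    exact (hedge i j hij).trans (paramSpace_entry_le hΘ i j)
  have hmgf := sum_isingPmf_mul_exp_neg_le hθ0 hθ' (paramSpace_nonneg hθ0 hΘ) hedge
  rw [← exp_neg_log_card hne]
  set L := Real.log ℋ.card
  have hL0 : 0 ≤ L := Real.log_natCast_nonneg _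
  set E : ℝ := (numEdges H : ℝ) with hEdef
  set r := scanRate 𝒢 ℋ n
  have hnE : 0 ≤ n * E := by positivity
  refine (sampleProb_le_exp_mul_pow Θ _ (fun x => -(θ * edgeSum H x))
    (-(θ * (n * E * (θ / 4)))) fun x hx => ?_).trans ?_
  · rw [Finset.sum_neg_distrib, ← Finset.mul_sum]
    refine neg_le_neg (mul_le_mul_of_nonneg_left ?_ hθ0)
    have hx' : edgeCorr H x ≤ κ / 4 * r := scanTest_eq_zero hx hH
    have hx'' : edgeCorr H x ≤ θ / 4 := by linarith
    rw [edgeCorr_eq, ← hEdef, div_le_iff₀ (by positivity)] at hx''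
    linarith
  · calc _ ≤ Real.exp (- -(θ * (n * E * (θ / 4)))) *
            Real.exp (-(3 / 8 * (θ ^ 2 * E))) ^ n := by
          refine mul_le_mul_of_nonneg_left (pow_le_pow_left₀ ?_ hmgf n) (Real.exp_pos _).le
          exact Finset.sum_nonneg fun x _ =>
            mul_nonneg (isingPmf_nonneg Θ x) (Real.exp_pos _).le
      _ = Real.exp (-(n * E * θ ^ 2 / 8)) := by
          rw [← Real.exp_nat_mul, ← Real.exp_add]
          congr 1
          ring
      _ ≤ _ := by
          refine Real.exp_le_exp.2 (neg_le_neg ?_)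
          have h1 : (κ * r) ^ 2 ≤ θ ^ 2 := pow_le_pow_left₀ hκr hθ.le 2
          have h2 := mul_le_mul_of_nonneg_left h1 hnE
          have h3 : 28 ^ 2 * (n * E * r ^ 2) ≤ κ ^ 2 * (n * E * r ^ 2) := by gcongr
          -- θ ≥ 28r and L ≤ 4nEr² give nEθ²/8 ≥ 98nEr² ≥ L.
          nlinarith

end IsingDetection

/-! ### The risk bound -/

theorem mainTheorem3 :
    ∃ κ₀ : ℝ, 0 < κ₀ ∧ ∀ κ : ℝ, κ₀ ≤ κ →
      ∀ α : ℝ, 0 < α → α < 1 →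
      ∀ (d : ℕ → ℕ) (𝒢 : ∀ n, Set (SimpleGraph (Fin (d n))))
        (ℋ : ∀ n, Finset (SimpleGraph (Fin (d n)))) (θ : ℕ → ℝ),
        (∀ n, (𝒢 n).Nonempty) →
        (∀ n, ⊥ ∉ 𝒢 n) →
        (∀ n, IsingDetection.IsWitnessingSet (𝒢 n) (ℋ n)) →
        (∀ n, ∀ H ∈ ℋ n,
          IsingDetection.classArboricity (𝒢 n) ≤ IsingDetection.densityIndex H) →
        Tendsto (fun n : ℕ => Real.log ((ℋ n).card : ℝ) / (n : ℝ)) atTop (𝓝 0) →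
        (∀ n, 2 / α ≤ ((ℋ n).card : ℝ)) →
        (∀ n, κ * IsingDetection.scanRate (𝒢 n) (ℋ n) n < θ n) →
        ∀ᶠ n : ℕ in atTop,
          IsingDetection.sampleProb n (0 : Matrix (Fin (d n)) (Fin (d n)) ℝ)
              {x | IsingDetection.scanTest κ (𝒢 n) (ℋ n) x = 1} +
            (⨆ Θ : IsingDetection.paramSpace (𝒢 n) (θ n),
              IsingDetection.sampleProb n Θ.1
                {x | IsingDetection.scanTest κ (𝒢 n) (ℋ n) x = 0}) ≤ α := by
  refine ⟨28, by norm_num, ?_⟩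
  intro κ hκ α hα _ d 𝒢 ℋ θ hne hbot hwit hdens hlim hcard hθ
  filter_upwards [hlim.eventually_le_const (by norm_num : (0 : ℝ) < 1 / 8),
    eventually_gt_atTop 0] with n hL hn
  have hR := IsingDetection.one_le_classArboricity (hne n) (hbot n)
  have hpos : (0 : ℝ) < (ℋ n).card := lt_of_lt_of_le (by positivity) (hcard n)
  have hℋ : (ℋ n).Nonempty := Finset.card_pos.1 (by exact_mod_cast hpos)
  have hinv : ((ℋ n).card : ℝ)⁻¹ ≤ α / 2 := by
    rw [← inv_div]
    exact inv_anti₀ (by positivity) (hcard n)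
  have h1 := IsingDetection.sampleProb_zero_scanTest_le hn hκ hℋ hR (hdens n) hL
  have h2 : (⨆ Θ : IsingDetection.paramSpace (𝒢 n) (θ n),
      IsingDetection.sampleProb n Θ.1
        {x | IsingDetection.scanTest κ (𝒢 n) (ℋ n) x = 0}) ≤ α / 2 :=
    -- The real supremum over an empty parameter space is 0, hence the side goal 0 ≤ α/2.
    Real.iSup_le (fun Θ => (IsingDetection.sampleProb_scanTest_eq_zero_le hn hκ hℋ hR
      (hdens n) (hwit n) (hθ n) Θ.2).trans hinv) (by positivity)
  linarith
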